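/- Let $(R,\mathfrak m)$ be a commutative Noetherian local ring and let $M$ and $N$ be nonzero finitely generated $R$-modules. A finitely generated $R$-module $L\neq 0$ is called Cohen–Macaulay if $\operatorname{depth}_R L=\dim_R L$, and maximal Cohen–Macaulay if moreover $\dim_R L=\dim R$. Call $M$ Ulrich if it is Cohen–Macaulay and $e_R(M)\le \ell_R(M/\mathfrak m M)$, where $\ell_R$ denotes length and, with $d=\dim_R M$, $e_R(M)=d!\,\lim_{n\to\infty}\ell_R(M/\mathfrak m^nM)/n^{d}$ is the Hilbert–Samuel multiplicity (an Ulrich module is not required to be maximal Cohen–Macaulay). Say that $N$ has rank if there is an integer $r\ge 0$ such that $N_{\mathfrak p}\cong R_{\mathfrak p}^{\oplus r}$ for every associated prime $\mathfrak p$ of $R$. Suppose that either $M$ is faithful (that is, $\operatorname{Ann}_R(M)=0$) or $N$ has rank. If $M$ is Ulrich and $M\otimes_R N$ is maximal Cohen–Macaulay, then $N$ is free. -/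

import Mathlib

open Filter Topology TensorProduct

noncomputable section

section LocalModules

universe u v

variable (R : Type u) [CommRing R] (M : Type v) [AddCommGroup M] [Module R M]

/-- The depth of a finitely generated module over a Noetherian local ring: the supremum of the
lengths of the `M`-regular sequences contained in the maximal ideal. For `M ≠ 0` the condition
`M ≠ (x₁, …, xₙ) M` in the definition of a regular sequence is automatic by Nakayama's lemma;
it is left out, so that the zero module has infinite depth. -/
def moduleDepth [IsLocalRing R] : ℕ∞ :=
  ⨆ (rs : List R) (_ : (∀ x ∈ rs, x ∈ IsLocalRing.maximalIdeal R) ∧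
    RingTheory.Sequence.IsWeaklyRegular M rs), (rs.length : ℕ∞)

/-- Cohen-Macaulay modules over a local ring: `depth M = dim M`, or `M = 0`. -/
def IsCohenMacaulayModule [IsLocalRing R] : Prop :=
  Subsingleton M ∨ (moduleDepth R M : WithBot ℕ∞) = Module.supportDim R M

/-- Maximal Cohen-Macaulay modules over a local ring: Cohen-Macaulay modules with
`dim M = dim R`, or `M = 0`. -/
def IsMaximalCohenMacaulayModule [IsLocalRing R] : Prop :=
  IsCohenMacaulayModule R M ∧ (Subsingleton M ∨ Module.supportDim R M = ringKrullDim R)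

/-- The dimension of a module as a natural number (finite for finitely generated modules over a
Noetherian local ring; by convention `0` for the zero module). -/
def moduleDimNat : ℕ := ((Module.supportDim R M).unbotD 0).toNat

variable {R}

/-- The Hilbert-Samuel multiplicity `e_R(I, M) = d! lim_{n → ∞} ℓ_R(M / Iⁿ M) / n ^ d`, where
`d = dim M`. The lengths are finite and the limit exists when `R` is Noetherian local, `I` is
primary to the maximal ideal and `M` is finitely generated. For `M = 0` the value is `0`. -/
def hilbertSamuelMultiplicity (I : Ideal R) : ℝ :=
  ((moduleDimNat R M).factorial : ℝ) *
    limUnder atTop (fun n : ℕ =>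
      ((Module.length R (M ⧸ (I ^ n • (⊤ : Submodule R M)))).toNat : ℝ) /
        (n : ℝ) ^ moduleDimNat R M)

/-- `M` is `c`-Ulrich with respect to `I`: it is Cohen-Macaulay, `M / I M` is free over `R / I`,
and `e_R(I, M) ≤ c · ℓ_R(M / I M)`. -/
structure IsCUlrichWithRespectTo [IsLocalRing R] (I : Ideal R) (c : ℝ) : Prop where
  isCohenMacaulay : IsCohenMacaulayModule R M
  free_quotient : Module.Free (R ⧸ I) (M ⧸ (I • (⊤ : Submodule R M)))
  multiplicity_le : hilbertSamuelMultiplicity M I ≤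
    c * ((Module.length R (M ⧸ (I • (⊤ : Submodule R M)))).toNat : ℝ)

variable (R)

/-- Ulrich modules: `1`-Ulrich modules with respect to the maximal ideal. (Only Cohen-Macaulay,
not maximal Cohen-Macaulay, is required.) -/
def IsUlrichModule [IsLocalRing R] : Prop :=
  IsCUlrichWithRespectTo M (IsLocalRing.maximalIdeal R) 1

/-- `M` has rank: for some `r`, the localization of `M` at each associated prime `p` of `R`
is free of rank `r` over `R_p`. -/
def HasModuleRank : Prop :=
  ∃ r : ℕ, ∀ (p : Ideal R) [p.IsPrime], p ∈ associatedPrimes R R →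
    Nonempty (LocalizedModule p.primeCompl M ≃ₗ[Localization.AtPrime p]
      (Fin r → Localization.AtPrime p))

end LocalModules

end

open IsLocalRing Polynomial
open scoped Pointwise

/-! Minimal generators b_1, …, b_n of N give a surjection φ : M^n → T = M ⊗ N whose kernel lies in m
M^n. The heart of the proof (`forall_eq_zero_of_sum_eq_zero`) is that φ is injective, by induction
on d = dim M. If d = 0, the Ulrich inequality reads ℓ(M) ≤ ℓ(M/mM), so mM = 0 and ker φ = 0. If d >
0, take x in m regular on M and T and superficial for M. Passing to M/xM and T/xT preserves the
hypotheses, multiplicity included, so φ is injective modulo x. Hence ker φ ⊆ xM^n, regularity of x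
on T gives ker φ = x ker φ, and Nakayama ends the step. Superficial elements need an infinite
residue field, obtained by passing to R[X] localized at mR[X].

A relation Σ a_i b_i = 0 puts (a_i v)_i in ker φ for every v in M, so all a_i annihilate M. If M is
faithful, the b_i form a basis. If N has rank r, then dim M = dim R puts Ann M inside an associated
prime p; the b_i stay minimal generators of N_p, so n = r. At each associated prime q the surjection
R_q^n → N_q ≅ R_q^n is then injective, so the a_i vanish in every R_q, hence in R. -/

theorem Submodule.exists_notMem_of_infinite_residueField {R M : Type*} [CommRing R] [IsLocalRing R]
    [Infinite (ResidueField R)] [AddCommGroup M] [Module R M] (s : Set (Submodule R M))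
    (hs : s.Finite) (htop : ⊤ ∉ s) : ∃ x : M, ∀ p ∈ s, x ∉ p := by
  by_contra! h
  have hcov : ⋃ p ∈ hs.toFinset, (p : Set M) = Set.univ := by
    ext x
    simpa using h x
  obtain ⟨p, hp, hfi⟩ := Submodule.exists_finiteIndex_of_cover hcov
  have hfin : Finite (M ⧸ p) := AddSubgroup.finite_quotient_of_finiteIndex
  have : Nontrivial (M ⧸ p) := Submodule.Quotient.nontrivial_iff.mpr
    (ne_of_mem_of_not_mem ((Set.Finite.mem_toFinset hs).mp hp) htop)
  obtain ⟨q, hq⟩ := exists_ne (0 : M ⧸ p)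
  -- Representatives of distinct residue classes differ by a unit, so they move q ≠ 0 to distinct
  -- elements of the finite module M/p.
  refine not_injective_infinite_finite
    (fun a : ResidueField R => (Function.surjInv (residue_surjective (R := R)) a) • q) ?_
  intro a b hab
  by_contra hne
  set r := Function.surjInv (residue_surjective (R := R)) a with hr
  set t := Function.surjInv (residue_surjective (R := R)) b with ht
  have hu : IsUnit (r - t) := by
    rw [← residue_ne_zero_iff_isUnit, map_sub, hr, ht,
      Function.surjInv_eq (residue_surjective (R := R)),
      Function.surjInv_eq (residue_surjective (R := R))]
    exact sub_ne_zero.mpr hne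
  apply hq
  rw [← hu.smul_eq_zero, sub_smul]
  exact sub_eq_zero.mpr hab

theorem Submodule.smul_mem_pow_succ_smul {A P : Type*} [CommRing A] [AddCommGroup P] [Module A P]
    {J : Ideal A} {E : Submodule A P} {a : A} {g : P} {n : ℕ} (ha : a ∈ J) (hg : g ∈ J ^ n • E) :
    a • g ∈ J ^ (n + 1) • E := by
  rw [pow_succ', mul_smul]
  exact Submodule.smul_mem_smul ha hg

/-! ### Superficial elements through the Rees algebra. -/

section Superficial

variable {R : Type*} [CommRing R] (I : Ideal R) (M : Type*) [AddCommGroup M] [Module R M]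

/-- The filtration `n ↦ I ^ (n + 1) M`. -/
def Ideal.shiftedFiltration : I.Filtration M where
  N n := I ^ (n + 1) • ⊤
  mono n := Submodule.smul_mono_left (Ideal.pow_le_pow_right (Nat.le_succ _))
  smul_le n := by rw [← mul_smul, ← pow_succ']

variable {I M}

/-- The inclusion of `I` in the Rees algebra as the component of degree one. -/
noncomputable def Ideal.reesDegreeOne : I →ₗ[R] reesAlgebra I where
  toFun x := ⟨monomial 1 (x : R), reesAlgebra.monomial_mem.mpr (by simp)⟩
  map_add' x y := by ext1; simp
  map_smul' r x := by ext1; simp [smul_monomial]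

theorem Ideal.reesDegreeOne_smul_single (x : I) (n : ℕ) (v : M) :
    I.reesDegreeOne x • PolynomialModule.single R n v =
      PolynomialModule.single R (n + 1) ((x : R) • v) := by
  change (monomial 1 (x : R) : R[X]) • PolynomialModule.single R n v = _
  rw [PolynomialModule.monomial_smul_single, add_comm]

theorem Ideal.Filtration.single_mem_submodule_iff (F : I.Filtration M) (n : ℕ) (v : M) :
    PolynomialModule.single R n v ∈ F.submodule ↔ v ∈ F.N n := by
  rw [Ideal.Filtration.mem_submodule]
  constructor
  · intro h
    simpa using h n
  · intro h i
    rw [PolynomialModule.coeff_single, Finsupp.single_apply]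
    split_ifs with h'
    · subst h'; exact h
    · exact Submodule.zero_mem _

/-- Lets statements about large powers of the irrelevant ideal be applied to homogeneous elements of
large degree in the Rees module. -/
theorem Ideal.single_mem_pow_smul_submodule (n : ℕ) (v : M)
    (hv : v ∈ I ^ n • (⊤ : Submodule R M)) :
    PolynomialModule.single R n v ∈ (Ideal.span (Set.range I.reesDegreeOne)) ^ n •
        (I.stableFiltration (⊤ : Submodule R M)).submodule := by
  induction n generalizing v with
  | zero =>
    rw [pow_zero, Submodule.one_smul, Ideal.Filtration.single_mem_submodule_iff]
    exact hv
  | succ n ih =>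
    rw [pow_succ', mul_smul] at hv
    refine Submodule.smul_induction_on hv (fun r hr w hw => ?_) (fun a b ha hb => ?_)
    · rw [← Ideal.reesDegreeOne_smul_single ⟨r, hr⟩ n w]
      exact Submodule.smul_mem_pow_succ_smul (Ideal.subset_span ⟨_, rfl⟩) (ih w hw)
    · rw [PolynomialModule.single_add]
      exact Submodule.add_mem _ ha hb

/-- If `a` lies in no associated prime of `M` that does not contain `J`, then the
elements of `Jⁿ M` killed by `a` vanish for large `n`. -/
theorem Ideal.exists_forall_pow_smul_eq_zero_of_smul_eq_zero {A G : Type*} [CommRing A]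
    [IsNoetherianRing A] [AddCommGroup G] [Module A G] [Module.Finite A G] (J : Ideal A) (a : A)
    (ha : ∀ P ∈ associatedPrimes A G, a ∈ P → J ≤ P) :
    ∃ n₀, ∀ n ≥ n₀, ∀ g ∈ J ^ n • (⊤ : Submodule A G), a • g = 0 → g = 0 := by
  set H : Submodule A G := LinearMap.ker (LinearMap.lsmul A G a) with hH
  have haH : a ∈ Module.annihilator A H := by
    rw [Module.mem_annihilator]
    rintro ⟨h, hh⟩
    exact Subtype.ext (by simpa [hH] using hh)
  -- Minimal primes of Ann H are associated primes of G, and they contain a, hence J.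
  have hJ : J ≤ (Module.annihilator A H).radical := by
    rw [← Ideal.sInf_minimalPrimes]
    refine le_sInf fun P hP => ha P ?_ (hP.1.2 haH)
    exact associatedPrimes.subset_of_injective H.injective_subtype
      (Module.associatedPrimes.minimalPrimes_annihilator_subset_associatedPrimes A H hP)
  obtain ⟨c, hc⟩ := Ideal.exists_pow_le_of_le_radical_of_fg hJ (IsNoetherian.noetherian J)
  -- By Artin–Rees, JⁿG ∩ H lies in J^(n-k) H, which J^c ≤ Ann H kills once n ≥ k + c.
  obtain ⟨k, hk⟩ := Ideal.exists_pow_inf_eq_pow_smul J H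
  refine ⟨k + c, fun n hn g hg hag => ?_⟩
  have hgH : g ∈ J ^ n • ⊤ ⊓ H := ⟨hg, by simpa [hH] using hag⟩
  rw [hk n (by omega)] at hgH
  have h0 : J ^ (n - k) • (J ^ k • ⊤ ⊓ H) ≤ (⊥ : Submodule A G) := by
    rw [Submodule.smul_le]
    intro r hr w hw
    have hr' := hc (Ideal.pow_le_pow_right (show c ≤ n - k by omega) hr)
    have := Module.mem_annihilator.mp hr' ⟨w, hw.2⟩
    simpa using congrArg Subtype.val this
  simpa using h0 hgH

/-- There are finitely many ideals such that multiplication by any `a` outside of them (except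
possibly those containing `J`) is injective modulo `E₁` on `Jⁿ E` for large `n`. -/
theorem Ideal.exists_finite_forall_pow_smul_mem {A P : Type*} [CommRing A] [IsNoetherianRing A]
    [AddCommGroup P] [Module A P] (J : Ideal A) (E E₁ : Submodule A P) (hE : E.FG) :
    ∃ s : Set (Ideal A), s.Finite ∧ ∀ a : A, (∀ Q ∈ s, a ∈ Q → J ≤ Q) →
      ∃ n₀, ∀ n ≥ n₀, ∀ g ∈ J ^ n • E, a • g ∈ E₁ → g ∈ E₁ := by
  have : Module.Finite A (E.map E₁.mkQ) := Module.Finite.iff_fg.mpr (hE.map _)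
  refine ⟨associatedPrimes A (E.map E₁.mkQ), associatedPrimes.finite _ _, fun a ha => ?_⟩
  obtain ⟨n₀, hn₀⟩ := J.exists_forall_pow_smul_eq_zero_of_smul_eq_zero a ha
  refine ⟨n₀, fun n hn g hg hag => ?_⟩
  have h1 : E₁.mkQ g ∈ J ^ n • E.map E₁.mkQ := by
    rw [← Submodule.map_smul'']
    exact Submodule.mem_map_of_mem hg
  have h2 : E₁.mkQ g ∈ (J ^ n • (⊤ : Submodule A (E.map E₁.mkQ))).map
      (E.map E₁.mkQ).subtype := by
    rwa [Submodule.map_smul'', Submodule.map_top, Submodule.range_subtype]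
  obtain ⟨w, hw, hwg⟩ := h2
  have h3 := hn₀ n hn w hw (by
    apply Subtype.ext
    rw [Submodule.coe_smul]
    change a • (E.map E₁.mkQ).subtype w = 0
    rw [hwg, ← map_smul]
    exact (Submodule.Quotient.mk_eq_zero _).mpr hag)
  rw [h3, map_zero] at hwg
  simpa using hwg.symm

end Superficial

/-- Existence of superficial elements avoiding finitely many proper ideals. -/
theorem IsLocalRing.exists_superficial {R M : Type*} [CommRing R] [IsNoetherianRing R]
    [IsLocalRing R] [Infinite (ResidueField R)] [AddCommGroup M] [Module R M] [Module.Finite R M]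
    (s : Set (Ideal R)) (hs : s.Finite) (hsm : ∀ p ∈ s, ¬ maximalIdeal R ≤ p) :
    ∃ x ∈ maximalIdeal R, (∀ p ∈ s, x ∉ p) ∧ ∃ n₀, ∀ n ≥ n₀,
      ∀ v ∈ maximalIdeal R ^ n • (⊤ : Submodule R M),
        x • v ∈ maximalIdeal R ^ (n + 2) • (⊤ : Submodule R M) →
          v ∈ maximalIdeal R ^ (n + 1) • (⊤ : Submodule R M) := by
  set I := maximalIdeal R
  set J : Ideal (reesAlgebra I) := Ideal.span (Set.range I.reesDegreeOne)
  -- The quotient of these two Rees modules is the associated graded module ⊕ IⁿM / Iⁿ⁺¹M.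
  obtain ⟨u, hu, hus⟩ := J.exists_finite_forall_pow_smul_mem
    (I.stableFiltration (⊤ : Submodule R M)).submodule (I.shiftedFiltration M).submodule
    (((I.stableFiltration ⊤).submodule_fg_iff_stable
      fun _ => IsNoetherian.noetherian _).mpr (I.stableFiltration_stable ⊤))
  set t₁ : Set (Submodule R I) := (fun p : Ideal R => Submodule.comap I.subtype p) '' s
  set t₂ : Set (Submodule R I) :=
    (fun P : Ideal (reesAlgebra I) => (P.restrictScalars R).comap I.reesDegreeOne) ''
      {P ∈ u | ¬ J ≤ P}
  have hfin : (t₁ ∪ t₂).Finite := (hs.image _).union ((hu.subset (fun _ h => h.1)).image _)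
  -- All conditions on x become avoidance of finitely many proper submodules of I itself.
  obtain ⟨x, hx⟩ := Submodule.exists_notMem_of_infinite_residueField (t₁ ∪ t₂) hfin (by
    rintro (⟨p, hp, h⟩ | ⟨P, ⟨-, hP⟩, h⟩)
    · refine hsm p hp fun y hy => ?_
      exact (Submodule.eq_top_iff'.mp h) ⟨y, hy⟩
    · refine hP (Ideal.span_le.mpr ?_)
      rintro _ ⟨y, rfl⟩
      exact (Submodule.eq_top_iff'.mp h) y)
  refine ⟨x, x.2, fun p hp h => hx _ (Or.inl ⟨p, hp, rfl⟩) h, ?_⟩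
  obtain ⟨n₀, hn₀⟩ := hus (I.reesDegreeOne x) (fun P hP hxP => by
    by_contra h
    exact hx _ (Or.inr ⟨P, ⟨hP, h⟩, rfl⟩) hxP)
  refine ⟨n₀, fun n hn v hv hxv => ?_⟩
  have := hn₀ n hn _ (Ideal.single_mem_pow_smul_submodule n v hv) (by
    rw [Ideal.reesDegreeOne_smul_single, Ideal.Filtration.single_mem_submodule_iff]
    exact hxv)
  rwa [Ideal.Filtration.single_mem_submodule_iff] at this

theorem isSMulRegular_of_forall_notMem_associatedPrimes {R L : Type*} [CommRing R]
    [IsNoetherianRing R] [AddCommGroup L] [Module R L] {x : R}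
    (h : ∀ p ∈ associatedPrimes R L, x ∉ p) : IsSMulRegular L x := by
  by_contra hx
  have : x ∈ ⋃ p ∈ associatedPrimes R L, (p : Set R) := by
    rw [biUnion_associatedPrimes_eq_compl_regular]; exact hx
  simp only [Set.mem_iUnion] at this
  obtain ⟨p, hp, hxp⟩ := this
  exact h p hp hxp

/-- For a superficial nonzerodivisor `x`, one has `(mⁿ⁺¹ M : x) = mⁿ M` for large `n`. -/
theorem IsLocalRing.exists_superficial_of_isSMulRegular {R M : Type*} [CommRing R]
    [IsNoetherianRing R] [IsLocalRing R] [Infinite (ResidueField R)] [AddCommGroup M] [Module R M]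
    [Module.Finite R M] (hM : maximalIdeal R ∉ associatedPrimes R M)
    {T : Type*} [AddCommGroup T] [Module R T] [Module.Finite R T]
    (hT : maximalIdeal R ∉ associatedPrimes R T) :
    ∃ x ∈ maximalIdeal R, IsSMulRegular M x ∧ IsSMulRegular T x ∧ ∃ n₀, ∀ n ≥ n₀, ∀ v : M,
        x • v ∈ maximalIdeal R ^ (n + 1) • (⊤ : Submodule R M) →
          v ∈ maximalIdeal R ^ n • (⊤ : Submodule R M) := by
  obtain ⟨x, hx, hxp, n₀, hn₀⟩ := IsLocalRing.exists_superficial (R := R) (M := M)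
    (associatedPrimes R M ∪ associatedPrimes R T)
    ((associatedPrimes.finite R M).union (associatedPrimes.finite R T)) (by
      rintro p (hp | hp) hle
      · exact hM ((IsLocalRing.maximalIdeal.isMaximal R).eq_of_le hp.isPrime.ne_top hle ▸ hp)
      · exact hT ((IsLocalRing.maximalIdeal.isMaximal R).eq_of_le hp.isPrime.ne_top hle ▸ hp))
  have hregM : IsSMulRegular M x :=
    isSMulRegular_of_forall_notMem_associatedPrimes fun p hp => hxp p (Or.inl hp)
  have hregT : IsSMulRegular T x :=
    isSMulRegular_of_forall_notMem_associatedPrimes fun p hp => hxp p (Or.inr hp)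
  refine ⟨x, hx, hregM, hregT, ?_⟩
  set I := maximalIdeal R
  -- Artin–Rees for xM, with x cancelled, places v in the power n + 1 - k. Superficiality then
  -- raises the exponent one at a time up to n, since j < n gives xv ∈ Iⁿ⁺¹M ⊆ I^(j+2) M.
  obtain ⟨k, hk⟩ := Ideal.exists_pow_inf_eq_pow_smul I (LinearMap.range (LinearMap.lsmul R M x))
  refine ⟨n₀ + k, fun n hn v hv => ?_⟩
  have h1 : v ∈ I ^ (n + 1 - k) • (⊤ : Submodule R M) := by
    have : x • v ∈ I ^ (n + 1) • ⊤ ⊓ LinearMap.range (LinearMap.lsmul R M x) := ⟨hv, v, rfl⟩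
    rw [hk _ (by omega)] at this
    have h2 : I ^ (n + 1 - k) • (I ^ k • ⊤ ⊓ LinearMap.range (LinearMap.lsmul R M x)) ≤
        (I ^ (n + 1 - k) • (⊤ : Submodule R M)).map (LinearMap.lsmul R M x) := by
      rw [Submodule.map_smul'', Submodule.map_top]
      exact Submodule.smul_mono le_rfl inf_le_right
    obtain ⟨w, hw, hwv⟩ := h2 this
    rwa [← hregM hwv]
  have h2 : ∀ j, n₀ ≤ j → j ≤ n → v ∈ I ^ (n + 1 - k) • (⊤ : Submodule R M) →
      n + 1 - k ≤ j → v ∈ I ^ j • (⊤ : Submodule R M) := by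
    intro j hj hjn hv1 hkj
    induction j, hkj using Nat.le_induction with
    | base => exact hv1
    | succ j hkj ih =>
      exact hn₀ j (by omega) v (ih (by omega) (by omega))
        (Submodule.smul_mono_left (Ideal.pow_le_pow_right (by omega)) hv)
  rcases Nat.eq_zero_or_pos k with rfl | hkpos
  · exact Submodule.smul_mono_left (Ideal.pow_le_pow_right (by omega)) h1
  · exact h2 n (by omega) le_rfl h1 (by omega)

/-! ### Depth and regular sequences. -/

section RegularSequences

universe u v

variable (R : Type u) [CommRing R] [IsLocalRing R] (M : Type v) [AddCommGroup M] [Module R M]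

/-- There is a weakly `M`-regular sequence of length `d` in the maximal ideal. -/
def HasWeaklyRegularSequence (d : ℕ) : Prop :=
  ∃ rs : List R, rs.length = d ∧ (∀ x ∈ rs, x ∈ maximalIdeal R) ∧
    RingTheory.Sequence.IsWeaklyRegular M rs

variable {R M}

theorem HasWeaklyRegularSequence.of_le {d e : ℕ} (h : HasWeaklyRegularSequence R M e)
    (hde : d ≤ e) : HasWeaklyRegularSequence R M d := by
  obtain ⟨rs, hl, hm, hr⟩ := h
  refine ⟨rs.take d, by simp [hl, hde], fun x hx => hm x (List.mem_of_mem_take hx), ?_⟩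
  rw [← List.take_append_drop d rs, RingTheory.Sequence.isWeaklyRegular_append_iff] at hr
  exact hr.1

/-- A finite supremum of natural numbers is attained: otherwise truncation bounds every length by d
- 1. -/
theorem HasWeaklyRegularSequence.of_moduleDepth_eq {d : ℕ} (h : moduleDepth R M = d) :
    HasWeaklyRegularSequence R M d := by
  by_contra hd
  have hlt : ∀ e, HasWeaklyRegularSequence R M e → e < d := fun e he => by
    by_contra! hle
    exact hd (he.of_le hle)
  rcases d with _ | d
  · exact hd ⟨[], rfl, by simp, .nil R M⟩
  · have : moduleDepth R M ≤ (d : ℕ∞) := by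
      refine iSup₂_le fun rs hrs => ?_
      have := hlt rs.length ⟨rs, rfl, hrs.1, hrs.2⟩
      exact_mod_cast Nat.lt_succ_iff.mp this
    rw [h] at this
    have : d + 1 ≤ d := by exact_mod_cast this
    omega

theorem HasWeaklyRegularSequence.maximalIdeal_notMem_associatedPrimes {d : ℕ}
    (h : HasWeaklyRegularSequence R M (d + 1)) : maximalIdeal R ∉ associatedPrimes R M := by
  obtain ⟨rs, hl, hm, hr⟩ := h
  match rs with
  | [] => simp at hl
  | x :: rs =>
    rw [RingTheory.Sequence.isWeaklyRegular_cons_iff] at hr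
    rintro hass
    have hmem := hm x (by simp)
    rw [AssociatedPrimes.mem_iff] at hass
    have := hass.annihilator_le
    obtain ⟨hp, v, hv⟩ := hass
    -- An associated prime is given here as the radical of the annihilator of v, so only a power of
    -- x is known to kill v.
    have hn : ∀ n : ℕ, x ^ n • v = 0 → v = 0 := fun n h0 => (hr.1.pow n) (by simpa using h0)
    rw [hv] at hmem
    obtain ⟨n, hn'⟩ := hmem
    have hv0 := hn n (by simpa [Submodule.mem_colon_singleton] using hn')
    apply hp.ne_top
    rw [hv, hv0]
    simp

/-- Since x need not begin the given sequence, depth is read off from vanishing of Ext: in the long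
exact sequence of multiplication by x, Ext^i into M/xM sits between Ext^i and Ext^(i+1) into M. -/
theorem HasWeaklyRegularSequence.quotSMulTop [Small.{v} R] [IsNoetherianRing R] [Module.Finite R M]
    [Nontrivial M] {d : ℕ} (h : HasWeaklyRegularSequence R M (d + 1)) {x : R}
    (hx : x ∈ maximalIdeal R) (hreg : IsSMulRegular M x) :
    HasWeaklyRegularSequence R (QuotSMulTop x M) d := by
  have hlt : ∀ (L : Type v) [AddCommGroup L] [Module R L] [Module.Finite R L] [Nontrivial L],
      maximalIdeal R • (⊤ : Submodule R L) < ⊤ := fun L _ _ _ _ =>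
    lt_top_iff_ne_top.mpr (Submodule.top_ne_ideal_smul_of_le_jacobson_annihilator
      (maximalIdeal_le_jacobson _)).symm
  have : Nontrivial (QuotSMulTop x M) := nontrivial_quotSMulTop_of_mem_maximalIdeal M hx
  have h1 := ((ModuleCat.exists_isRegular_tfae (maximalIdeal R) (d + 1) (ModuleCat.of R M)
    (hlt M)).out 1 3).mpr (by
      obtain ⟨rs, hl, hm, hr⟩ := h
      exact ⟨rs, hl, hm, .of_isWeaklyRegular_of_mem_maximalIdeal M hm hr⟩)
  obtain ⟨rs, hl, hm, hr⟩ := ((ModuleCat.exists_isRegular_tfae (maximalIdeal R) d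
    (ModuleCat.of R (QuotSMulTop x M)) (hlt _)).out 1 3).mp (by
      intro i hi
      have zero1 := AddCommGrpCat.isZero_of_iff_subsingleton.mpr (h1 i (by omega))
      have zero2 := AddCommGrpCat.isZero_of_iff_subsingleton.mpr (h1 (i + 1) (by omega))
      have hreg' : IsSMulRegular (ModuleCat.of R M) x := hreg
      exact AddCommGrpCat.subsingleton_of_isZero <|
        CategoryTheory.ShortComplex.Exact.isZero_of_both_zeros
        ((CategoryTheory.Abelian.Ext.covariant_sequence_exact₃' _
          hreg'.smulShortComplex_shortExact) i (i + 1) rfl)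
        (zero1.eq_zero_of_src _) (zero2.eq_zero_of_tgt _))
  exact ⟨rs, hl, hm, hr.toIsWeaklyRegular⟩

end RegularSequences

/-! ### Growth rates of sequences. -/

theorem tendsto_add_one_pow_sub_pow_div (d : ℕ) :
    Tendsto (fun n : ℕ => (((n : ℝ) + 1) ^ (d + 1) - (n : ℝ) ^ (d + 1)) / ((n : ℝ) + 1) ^ d) atTop
      (𝓝 (d + 1)) := by
  have h1 : Tendsto (fun n : ℕ => ((n : ℝ) / ((n : ℝ) + 1))) atTop (𝓝 1) := by
    simpa using tendsto_natCast_div_add_atTop (1 : ℝ)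
  have h2 : Tendsto (fun n : ℕ => ∑ i ∈ Finset.range (d + 1), ((n : ℝ) / ((n : ℝ) + 1)) ^ (d - i))
      atTop (𝓝 (∑ i ∈ Finset.range (d + 1), (1 : ℝ) ^ (d - i))) :=
    tendsto_finsetSum _ fun i _ => h1.pow _
  have h3 : (∑ i ∈ Finset.range (d + 1), (1 : ℝ) ^ (d - i)) = d + 1 := by simp
  rw [h3] at h2
  refine h2.congr fun n => ?_
  have hn : ((n : ℝ) + 1) ≠ 0 := by positivity
  rw [← (Commute.all ((n : ℝ) + 1) (n : ℝ)).mul_geom_sum₂, add_sub_cancel_left, one_mul,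
    Finset.sum_div]
  refine Finset.sum_congr rfl fun i hi => ?_
  have hi' : i ≤ d := by simpa [Nat.lt_succ_iff] using hi
  rw [div_pow, div_eq_div_iff (by positivity) (by positivity)]
  have : d + 1 - 1 - i = d - i := by omega
  rw [this]
  calc (n : ℝ) ^ (d - i) * ((n : ℝ) + 1) ^ d
      = (n : ℝ) ^ (d - i) * ((n : ℝ) + 1) ^ (i + (d - i)) := by rw [Nat.add_sub_cancel' hi']
    _ = _ := by rw [pow_add]; ring

/-- A Stolz-Cesàro theorem for the growth rate `n ^ d`. -/
theorem tendsto_div_pow_succ_of_eventually_sub {f g : ℕ → ℝ} {c : ℝ} {d : ℕ}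
    (hfg : ∀ᶠ n in atTop, f (n + 1) = f n + g (n + 1))
    (hg : Tendsto (fun n => g n / (n : ℝ) ^ d) atTop (𝓝 c)) :
    Tendsto (fun n => f n / (n : ℝ) ^ (d + 1)) atTop (𝓝 (c / (d + 1))) := by
  set w : ℕ → ℝ := fun n => ((n + 1 : ℕ) : ℝ) ^ (d + 1) - (n : ℝ) ^ (d + 1) with hw
  have hwpos : ∀ n, 0 < w n := fun n => by
    have : (n : ℝ) < ((n + 1 : ℕ) : ℝ) := by push_cast; linarith
    exact sub_pos.mpr (pow_lt_pow_left₀ this (by positivity) (by omega))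
  have hwsum : ∀ N, ∑ i ∈ Finset.range N, w i = (N : ℝ) ^ (d + 1) := fun N => by
    rw [hw, Finset.sum_range_sub (fun n : ℕ => (n : ℝ) ^ (d + 1))]; simp
  have hinf : Tendsto (fun N : ℕ => (N : ℝ) ^ (d + 1)) atTop atTop :=
    (tendsto_pow_atTop (by omega)).comp tendsto_natCast_atTop_atTop
  have hd : (d : ℝ) + 1 ≠ 0 := by positivity
  -- The increments of f are asymptotic to c / (d + 1) times w in this sense; little-o relations can
  -- be summed because the partial sums N^(d+1) of w diverge.
  have hu : (fun n => f (n + 1) - f n - c / (d + 1) * w n) =o[atTop] w := by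
    rw [Asymptotics.isLittleO_iff_tendsto fun n h => absurd h (hwpos n).ne']
    have h1 : Tendsto (fun n : ℕ => g (n + 1) / ((n + 1 : ℕ) : ℝ) ^ d) atTop (𝓝 c) :=
      hg.comp (tendsto_add_atTop_nat 1)
    have h2 := ((h1.div (tendsto_add_one_pow_sub_pow_div d) hd).sub_const (c / (d + 1)))
    rw [sub_self] at h2
    refine h2.congr' ?_
    filter_upwards [hfg] with n hn
    have h3 : ((n : ℝ) + 1) ^ d ≠ 0 := by positivity
    have h4 := (hwpos n).ne'
    have h5 : w n = ((n : ℝ) + 1) ^ (d + 1) - (n : ℝ) ^ (d + 1) := by simp [hw]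
    simp only [Pi.div_apply, hn, add_sub_cancel_left, ← h5]
    rw [Nat.cast_add_one]
    rw [sub_div (g (n + 1)), mul_div_cancel_right₀ _ h4, div_div_div_cancel_right₀ h3]
  have hs := hu.sum_range (fun n => (hwpos n).le) (by simpa only [hwsum] using hinf)
  simp only [hwsum, Finset.sum_sub_distrib, ← Finset.mul_sum] at hs
  simp only [← Finset.sum_sub_distrib, Finset.sum_range_sub] at hs
  have h6 := hs.tendsto_div_nhds_zero
  have h7 : Tendsto (fun n : ℕ => f 0 / (n : ℝ) ^ (d + 1)) atTop (𝓝 0) :=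
    hinf.const_div_atTop _
  have h8 := (h6.add h7).add_const (c / (d + 1))
  rw [zero_add, zero_add] at h8
  refine h8.congr' ?_
  filter_upwards [eventually_gt_atTop 0] with n hn
  have : (n : ℝ) ^ (d + 1) ≠ 0 := by positivity
  field_simp
  ring

theorem nontrivial_of_supportDim_eq_natCast {R M : Type*} [CommRing R] [AddCommGroup M]
    [Module R M] {d : ℕ} (h : Module.supportDim R M = d) : Nontrivial M := by
  rw [← Module.supportDim_ne_bot_iff_nontrivial R, h]
  exact WithBot.natCast_ne_bot d

/-! ### Hilbert–Samuel functions modulo a superficial element. -/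

section HilbertSamuel

universe u v

variable (R : Type u) [CommRing R] [IsLocalRing R] (M : Type v) [AddCommGroup M] [Module R M]

/-- The Hilbert-Samuel function `n ↦ ℓ(M / mⁿ M)`. -/
noncomputable def hilbertSamuelFunction (n : ℕ) : ℕ :=
  (Module.length R (M ⧸ (maximalIdeal R ^ n • (⊤ : Submodule R M)))).toNat

variable {R M} [IsNoetherianRing R]

theorem isFiniteLength_quotient_maximalIdeal_pow_smul [Module.Finite R M] (n : ℕ) :
    IsFiniteLength R (M ⧸ (maximalIdeal R ^ n • (⊤ : Submodule R M))) := by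
  rw [isFiniteLength_iff_isNoetherian_isArtinian]
  refine ⟨inferInstance, ?_⟩
  rcases Nat.eq_zero_or_pos n with rfl | hn
  · have : Subsingleton (M ⧸ (maximalIdeal R ^ 0 • (⊤ : Submodule R M))) := by
      rw [Submodule.Quotient.subsingleton_iff]; simp
    infer_instance
  have hne : maximalIdeal R ^ n ≠ ⊤ := fun h => (IsLocalRing.maximalIdeal.isMaximal R).ne_top
    (top_le_iff.mp (h ▸ Ideal.pow_le_self hn.ne'))
  have : Nontrivial (R ⧸ maximalIdeal R ^ n) := Ideal.Quotient.nontrivial_iff.mpr hne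
  have : IsLocalRing (R ⧸ maximalIdeal R ^ n) :=
    .of_surjective' (Ideal.Quotient.mk _) Ideal.Quotient.mk_surjective
  have : IsArtinianRing (R ⧸ maximalIdeal R ^ n) := by
    rw [isArtinianRing_iff_isNilpotent_maximalIdeal]
    refine ⟨n, ?_⟩
    have hcomap : (maximalIdeal (R ⧸ maximalIdeal R ^ n)).comap
        (Ideal.Quotient.mk (maximalIdeal R ^ n)) = maximalIdeal R :=
      IsLocalRing.eq_maximalIdeal
        (Ideal.comap_isMaximal_of_surjective _ Ideal.Quotient.mk_surjective)
    rw [← Ideal.map_comap_of_surjective _ Ideal.Quotient.mk_surjective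
      (maximalIdeal (R ⧸ maximalIdeal R ^ n)), hcomap, ← Ideal.map_pow, Ideal.map_quotient_self]
    rfl
  have : Module.Finite (R ⧸ maximalIdeal R ^ n)
    (M ⧸ (maximalIdeal R ^ n • (⊤ : Submodule R M))) := Module.Finite.of_restrictScalars_finite R _ _
  have : IsArtinian (R ⧸ maximalIdeal R ^ n)
    (M ⧸ (maximalIdeal R ^ n • (⊤ : Submodule R M))) := inferInstance
  exact isArtinian_of_surjective_algebraMap (R := R ⧸ maximalIdeal R ^ n)
    Ideal.Quotient.mk_surjective

/-- Length is additive on 0 → M/mⁿM → M/mⁿ⁺¹M → M̄/mⁿ⁺¹M̄ → 0 with M̄ = M/xM and first map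
multiplication by x; `h` is its injectivity. -/
theorem hilbertSamuelFunction_succ [Module.Finite R M] {x : R} {n : ℕ}
    (hx : x ∈ maximalIdeal R)
    (h : ∀ v : M, x • v ∈ maximalIdeal R ^ (n + 1) • (⊤ : Submodule R M) →
      v ∈ maximalIdeal R ^ n • (⊤ : Submodule R M)) :
    hilbertSamuelFunction R M (n + 1) =
      hilbertSamuelFunction R M n + hilbertSamuelFunction R (QuotSMulTop x M) (n + 1) := by
  set I := maximalIdeal R
  have hle1 : I ^ n • (⊤ : Submodule R M) ≤ (I ^ (n + 1) • (⊤ : Submodule R M)).comap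
      (LinearMap.lsmul R M x) := fun v hv => by
    rw [Submodule.mem_comap, LinearMap.lsmul_apply]
    exact Submodule.smul_mem_pow_succ_smul hx hv
  have hmap : (I ^ (n + 1) • (⊤ : Submodule R M)).map (x • (⊤ : Submodule R M)).mkQ =
      I ^ (n + 1) • (⊤ : Submodule R (QuotSMulTop x M)) := by
    rw [Submodule.map_smul'', Submodule.map_top, Submodule.range_mkQ]
  have hle2 : I ^ (n + 1) • (⊤ : Submodule R M) ≤
      (I ^ (n + 1) • (⊤ : Submodule R (QuotSMulTop x M))).comap (x • (⊤ : Submodule R M)).mkQ := by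
    rw [← Submodule.map_le_iff_le_comap, hmap]
  have hadd := Module.length_eq_add_of_exact
    (Submodule.mapQ _ _ (LinearMap.lsmul R M x) hle1)
    (Submodule.mapQ _ _ (x • (⊤ : Submodule R M)).mkQ hle2)
    (by
      rw [← LinearMap.ker_eq_bot, Submodule.ker_mapQ, ← LinearMap.le_ker_iff_map,
        Submodule.ker_mkQ]
      exact fun v hv => h v hv)
    (by
      rw [← LinearMap.range_eq_top, Submodule.range_mapQ, Submodule.range_mkQ, Submodule.map_top,
        Submodule.range_mkQ])
    (by
      rw [LinearMap.exact_iff, Submodule.ker_mapQ, Submodule.range_mapQ, ← hmap,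
        Submodule.comap_map_eq, Submodule.ker_mkQ, Submodule.map_sup]
      rw [Submodule.mkQ_map_self, bot_sup_eq]
      congr 1
      ext v
      simp [Submodule.mem_smul_pointwise_iff_exists])
  unfold hilbertSamuelFunction
  rw [hadd, ENat.toNat_add]
  · exact Module.length_ne_top_iff.mpr (isFiniteLength_quotient_maximalIdeal_pow_smul n)
  · exact Module.length_ne_top_iff.mpr (isFiniteLength_quotient_maximalIdeal_pow_smul (n + 1))

theorem exists_maximalIdeal_pow_smul_eq_bot_of_supportDim_eq_zero [Module.Finite R M]
    (h : Module.supportDim R M = 0) : ∃ c, maximalIdeal R ^ c • (⊤ : Submodule R M) = ⊥ := by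
  have h1 := support_of_supportDim_eq_zero R M h
  rw [Module.support_eq_zeroLocus, PrimeSpectrum.zeroLocus_eq_iff] at h1
  obtain ⟨c, hc⟩ := Ideal.exists_pow_le_of_le_radical_of_fg
    (h1 ▸ Ideal.le_radical : maximalIdeal R ≤ (Module.annihilator R M).radical)
    (IsNoetherian.noetherian _)
  refine ⟨c, eq_bot_iff.mpr (Submodule.smul_le.mpr fun r hr m _ => ?_)⟩
  exact (Submodule.mem_bot R).mpr (Module.mem_annihilator.mp (hc hr) m)

theorem hilbertSamuelFunction_eventually_eq_length [Module.Finite R M]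
    (h : Module.supportDim R M = 0) :
    ∀ᶠ n in atTop, hilbertSamuelFunction R M n = (Module.length R M).toNat := by
  obtain ⟨c, hc⟩ := exists_maximalIdeal_pow_smul_eq_bot_of_supportDim_eq_zero h
  filter_upwards [eventually_ge_atTop c] with n hn
  have : maximalIdeal R ^ n • (⊤ : Submodule R M) = ⊥ :=
    le_bot_iff.mp (hc ▸ Submodule.smul_mono_left (Ideal.pow_le_pow_right hn))
  unfold hilbertSamuelFunction
  rw [this, (Submodule.quotEquivOfEqBot (⊥ : Submodule R M) rfl).length_eq]

theorem isFiniteLength_of_supportDim_eq_zero [Module.Finite R M]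
    (h : Module.supportDim R M = 0) : IsFiniteLength R M := by
  obtain ⟨c, hc⟩ := exists_maximalIdeal_pow_smul_eq_bot_of_supportDim_eq_zero h
  exact (Submodule.quotEquivOfEqBot _ hc).isFiniteLength
    (isFiniteLength_quotient_maximalIdeal_pow_smul c)

theorem supportDim_quotSMulTop_eq [Module.Finite R M] {x : R} (hx : x ∈ maximalIdeal R)
    (hreg : IsSMulRegular M x) {d : ℕ} (h : Module.supportDim R M = (d + 1 : ℕ)) :
    Module.supportDim R (QuotSMulTop x M) = d := by
  have h1 := Module.supportDim_quotSMulTop_succ_eq_supportDim hreg hx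
  rw [h] at h1
  generalize Module.supportDim R (QuotSMulTop x M) = a at h1
  induction a using WithBot.recBotCoe with
  | bot => exact absurd h1 (WithBot.bot_ne_coe (a := ((d + 1 : ℕ) : ℕ∞)))
  | coe a =>
    induction a using ENat.recTopCoe with
    | top =>
      exact absurd (WithBot.coe_injective h1 : (⊤ : ℕ∞) + 1 = ((d + 1 : ℕ) : ℕ∞))
        (by rw [top_add]; exact ENat.top_ne_natCast _)
    | coe a =>
      have : a + 1 = d + 1 := by exact_mod_cast h1
      have : a = d := by omega
      rw [this]; rfl

/-- The Hilbert-Samuel multiplicity of a Cohen-Macaulay module exists as a limit. -/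
theorem exists_tendsto_hilbertSamuelFunction [Small.{v} R] [Infinite (ResidueField R)]
    (d : ℕ) (M : Type v) [AddCommGroup M] [Module R M] [Module.Finite R M] (hreg : HasWeaklyRegularSequence R M d)
    (hdim : Module.supportDim R M = d) :
    ∃ e : ℝ, Tendsto (fun n : ℕ => (hilbertSamuelFunction R M n : ℝ) / (n : ℝ) ^ d) atTop (𝓝 e) := by
  induction d generalizing M with
  | zero =>
    refine ⟨((Module.length R M).toNat : ℝ), tendsto_const_nhds.congr' ?_⟩
    filter_upwards [hilbertSamuelFunction_eventually_eq_length hdim] with n hn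
    simp [hn]
  | succ d ih =>
    have := nontrivial_of_supportDim_eq_natCast hdim
    obtain ⟨x, hx, hxM, -, n₀, hn₀⟩ := exists_superficial_of_isSMulRegular
      hreg.maximalIdeal_notMem_associatedPrimes hreg.maximalIdeal_notMem_associatedPrimes
    obtain ⟨e, he⟩ := ih (QuotSMulTop x M) (hreg.quotSMulTop hx hxM)
      (supportDim_quotSMulTop_eq hx hxM hdim)
    refine ⟨_, tendsto_div_pow_succ_of_eventually_sub ?_ he⟩
    filter_upwards [eventually_ge_atTop n₀] with n hn
    exact_mod_cast hilbertSamuelFunction_succ hx (hn₀ n hn)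

end HilbertSamuel

/-! ### Injectivity of the surjection, infinite residue field. -/

section Key

universe u v w

theorem maximalIdeal_smul_top_eq_bot_of_length_le {R : Type u} [CommRing R] [IsLocalRing R]
    {M : Type v} [AddCommGroup M] [Module R M] (hM : IsFiniteLength R M)
    (h : (Module.length R M).toNat ≤ hilbertSamuelFunction R M 1) :
    maximalIdeal R • (⊤ : Submodule R M) = ⊥ := by
  unfold hilbertSamuelFunction at h
  rw [pow_one] at h
  have hM' := Module.length_ne_top_iff.mpr hM
  have hadd := Module.length_eq_add_of_exact (maximalIdeal R • (⊤ : Submodule R M)).subtype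
    (maximalIdeal R • (⊤ : Submodule R M)).mkQ (Submodule.injective_subtype _)
    (Submodule.mkQ_surjective _) (LinearMap.exact_subtype_mkQ _)
  rw [hadd] at hM'
  rw [hadd, ENat.toNat_add (by aesop) (by aesop)] at h
  have h0 : (Module.length R (maximalIdeal R • (⊤ : Submodule R M) : Submodule R M)).toNat = 0 := by
    omega
  -- `toNat` also sends ⊤ to 0, so infinite length has to be excluded.
  rw [ENat.toNat_eq_zero] at h0
  rcases h0 with h0 | h0
  · rw [Module.length_eq_zero_iff] at h0
    exact Submodule.subsingleton_iff_eq_bot.mp h0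
  · simp [h0] at hM'

variable {R : Type u} [CommRing R] [IsLocalRing R] [IsNoetherianRing R]

/-- The case n = 0 of `hilbertSamuelFunction_succ`, where the condition on x is void because m⁰M =
M. -/
theorem hilbertSamuelFunction_quotSMulTop_one {M : Type v} [AddCommGroup M] [Module R M]
    [Module.Finite R M] {x : R} (hx : x ∈ maximalIdeal R) :
    hilbertSamuelFunction R (QuotSMulTop x M) 1 = hilbertSamuelFunction R M 1 := by
  have h := hilbertSamuelFunction_succ (M := M) (n := 0) hx (fun v _ => by simp)
  have h0 : hilbertSamuelFunction R M 0 = 0 := by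
    unfold hilbertSamuelFunction
    have : Subsingleton (M ⧸ (maximalIdeal R ^ 0 • (⊤ : Submodule R M))) := by
      rw [Submodule.Quotient.subsingleton_iff]; simp
    rw [Module.length_eq_zero]; rfl
  rw [h0, zero_add, zero_add] at h
  exact h.symm

/-- If `M` is Cohen-Macaulay of multiplicity at most `ℓ(M / m M)` and `T` has depth at least
`dim M`, then a surjection from a finite power of `M` onto `T` that is injective modulo the
maximal ideal is injective. -/
theorem forall_eq_zero_of_sum_eq_zero [Small.{v} R] [Small.{w} R] [Infinite (ResidueField R)]
    {ι : Type*} [Fintype ι] (d : ℕ) (M : Type v) [AddCommGroup M] [Module R M] [Module.Finite R M]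
    (hreg : HasWeaklyRegularSequence R M d) (hdim : Module.supportDim R M = d) (c : ℝ)
    (hc : Tendsto (fun n : ℕ => (hilbertSamuelFunction R M n : ℝ) / (n : ℝ) ^ d) atTop (𝓝 c))
    (hcle : (d.factorial : ℝ) * c ≤ hilbertSamuelFunction R M 1)
    (T : Type w) [AddCommGroup T] [Module R T] [Module.Finite R T] [Nontrivial T]
    (hT : HasWeaklyRegularSequence R T d) (φ : ι → M →ₗ[R] T)
    (hsurj : ∀ t, ∃ m : ι → M, ∑ i, φ i (m i) = t)
    (hker : ∀ m : ι → M, ∑ i, φ i (m i) = 0 → ∀ i, m i ∈ maximalIdeal R • (⊤ : Submodule R M))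
    (m : ι → M) (hm : ∑ i, φ i (m i) = 0) : m = 0 := by
  induction d generalizing M c T m with
  | zero =>
    have hlim : Tendsto (fun n : ℕ => (hilbertSamuelFunction R M n : ℝ) / (n : ℝ) ^ 0) atTop
        (𝓝 ((Module.length R M).toNat : ℝ)) := by
      refine tendsto_const_nhds.congr' ?_
      filter_upwards [hilbertSamuelFunction_eventually_eq_length hdim] with n hn
      simp [hn]
    rw [tendsto_nhds_unique hc hlim] at hcle
    have hbot := maximalIdeal_smul_top_eq_bot_of_length_le
      (isFiniteLength_of_supportDim_eq_zero hdim) (by simpa using hcle)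
    ext i
    simpa [hbot] using hker m hm i
  | succ d ih =>
    have := nontrivial_of_supportDim_eq_natCast hdim
    obtain ⟨x, hx, hxM, hxT, n₀, hn₀⟩ := exists_superficial_of_isSMulRegular
      hreg.maximalIdeal_notMem_associatedPrimes hT.maximalIdeal_notMem_associatedPrimes
    have hreg' := hreg.quotSMulTop hx hxM
    have hdim' := supportDim_quotSMulTop_eq hx hxM hdim
    obtain ⟨c', hc'⟩ := exists_tendsto_hilbertSamuelFunction d (QuotSMulTop x M) hreg' hdim'
    -- The factor d + 1 turns d! into (d + 1)!, so M and M/xM have the same multiplicity.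
    have hcc' : c = c' / (d + 1) := by
      refine tendsto_nhds_unique hc (tendsto_div_pow_succ_of_eventually_sub ?_ hc')
      filter_upwards [eventually_ge_atTop n₀] with n hn
      exact_mod_cast hilbertSamuelFunction_succ hx (hn₀ n hn)
    have hcle' : (d.factorial : ℝ) * c' ≤ hilbertSamuelFunction R (QuotSMulTop x M) 1 := by
      rw [hilbertSamuelFunction_quotSMulTop_one hx]
      refine le_trans (le_of_eq ?_) hcle
      rw [hcc', Nat.factorial_succ]
      have : (d : ℝ) + 1 ≠ 0 := by positivity
      push_cast
      field_simp
    have : Nontrivial (QuotSMulTop x T) := nontrivial_quotSMulTop_of_mem_maximalIdeal T hx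
    have hmk : ∀ m : ι → M, ∑ i, QuotSMulTop.map x (φ i) ((x • (⊤ : Submodule R M)).mkQ (m i)) =
        (x • (⊤ : Submodule R T)).mkQ (∑ i, φ i (m i)) := fun m => by
      rw [map_sum]; rfl
    have key := ih (QuotSMulTop x M) hreg' hdim' c' hc' hcle' (QuotSMulTop x T)
      (hT.quotSMulTop hx hxT) (fun i => QuotSMulTop.map x (φ i))
      (fun t => by
        obtain ⟨t, rfl⟩ := Submodule.mkQ_surjective _ t
        obtain ⟨m, rfl⟩ := hsurj t
        exact ⟨fun i => (x • (⊤ : Submodule R M)).mkQ (m i), hmk m⟩)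
      (fun m' hm' i => by
        choose m hmm using fun i => Submodule.mkQ_surjective (x • (⊤ : Submodule R M)) (m' i)
        simp only [← hmm] at hm' ⊢
        rw [hmk, Submodule.mkQ_apply, Submodule.Quotient.mk_eq_zero,
          Submodule.mem_smul_pointwise_iff_exists] at hm'
        obtain ⟨t, -, ht⟩ := hm'
        obtain ⟨w, rfl⟩ := hsurj t
        -- The image of m is xt with t the image of w, so m - xw lies in the kernel upstairs.
        have h1 := hker (fun i => m i - x • w i) (by
          simp only [map_sub, map_smul, Finset.sum_sub_distrib, ← Finset.smul_sum, ht, sub_self]) i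
        have h2 : m i ∈ maximalIdeal R • (⊤ : Submodule R M) := by
          rw [← sub_add_cancel (m i) (x • w i)]
          exact Submodule.add_mem _ h1 (Submodule.smul_mem_smul hx trivial)
        have h3 := Submodule.mem_map_of_mem (f := (x • (⊤ : Submodule R M)).mkQ) h2
        rwa [Submodule.map_smul'', Submodule.map_top, Submodule.range_mkQ] at h3)
    set f : (ι → M) →ₗ[R] T := ∑ i, φ i ∘ₗ LinearMap.proj i with hf
    have hfm : ∀ m, f m = ∑ i, φ i (m i) := fun m => by simp [hf]
    have hK : LinearMap.ker f ≤ maximalIdeal R • LinearMap.ker f := by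
      intro m hm
      rw [LinearMap.mem_ker, hfm] at hm
      have h1 := key (fun i => (x • (⊤ : Submodule R M)).mkQ (m i)) (by rw [hmk, hm, map_zero])
      have h2 : ∀ i, ∃ w, x • w = m i := fun i => by
        have := congrFun h1 i
        rw [Pi.zero_apply, Submodule.mkQ_apply, Submodule.Quotient.mk_eq_zero,
          Submodule.mem_smul_pointwise_iff_exists] at this
        obtain ⟨w, -, hw⟩ := this
        exact ⟨w, hw⟩
      choose w hw using h2
      have hmw : m = x • w := funext fun i => (hw i).symm
      rw [hmw]
      refine Submodule.smul_mem_smul hx ?_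
      rw [LinearMap.mem_ker, hfm]
      refine hxT ?_
      simp only [smul_zero, Finset.smul_sum, ← map_smul, hw, hm]
    have hbot := Submodule.eq_bot_of_le_smul_of_le_jacobson_bot (maximalIdeal R) (LinearMap.ker f)
      (IsNoetherian.noetherian _) hK (maximalIdeal_le_jacobson _)
    have : m ∈ LinearMap.ker f := by rw [LinearMap.mem_ker, hfm, hm]
    rwa [hbot, Submodule.mem_bot] at this

end Key

/-! ### Flat extension to an infinite residue field. -/

section BaseChange

universe u v w

/-- Every Noetherian local ring has a flat local extension `S` with `m S` maximal and infinite
residue field. -/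
theorem exists_flat_extension_infinite_residueField (R : Type u) [CommRing R] [IsLocalRing R]
    [IsNoetherianRing R] : ∃ (S : Type u) (_ : CommRing S) (_ : Algebra R S) (_ : IsLocalRing S),
      IsNoetherianRing S ∧ Module.Flat R S ∧
      (maximalIdeal R).map (algebraMap R S) = maximalIdeal S ∧ Infinite (ResidueField S) := by
  let p : Ideal (Polynomial R) := (maximalIdeal R).map Polynomial.C
  have hp : p.IsPrime := Ideal.isPrime_map_C_of_isPrime
  refine ⟨Localization.AtPrime p, inferInstance, inferInstance, inferInstance, ?_, ?_, ?_, ?_⟩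
  · exact IsLocalization.isNoetherianRing p.primeCompl _ inferInstance
  · have : Module.Flat (Polynomial R) (Localization.AtPrime p) := IsLocalization.flat _ p.primeCompl
    exact Module.Flat.trans R (Polynomial R) _
  · rw [IsScalarTower.algebraMap_eq R (Polynomial R) (Localization.AtPrime p), ← Ideal.map_map]
    exact Localization.AtPrime.map_eq_maximalIdeal
  -- The powers of X have distinct residues: X^i - X^j has a coefficient 1, so it is not in mR[X].
  · refine Infinite.of_injective (fun n : ℕ => residue (Localization.AtPrime p)
      (algebraMap (Polynomial R) _ (Polynomial.X ^ n))) fun i j hij => ?_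
    by_contra hne
    have h1 : algebraMap (Polynomial R) (Localization.AtPrime p)
        (Polynomial.X ^ i - Polynomial.X ^ j) ∈ maximalIdeal (Localization.AtPrime p) := by
      rw [← residue_eq_zero_iff, map_sub, map_sub]
      exact sub_eq_zero.mpr hij
    rw [IsLocalization.AtPrime.to_map_mem_maximal_iff (Localization.AtPrime p) p,
      Ideal.mem_map_C_iff] at h1
    have h2 := h1 i
    rw [Polynomial.coeff_sub, Polynomial.coeff_X_pow_self, Polynomial.coeff_X_pow, if_neg hne,
      sub_zero] at h2
    exact (maximalIdeal.isMaximal R).ne_top ((Ideal.eq_top_iff_one _).mpr h2)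

theorem mem_map_smul_top_of_lTensor_mkQ_eq_zero {R S : Type*} [CommRing R] [CommRing S]
    [Algebra R S] {M : Type*} [AddCommGroup M] [Module R M] (I : Ideal R) (z : S ⊗[R] M)
    (hz : (I • (⊤ : Submodule R M)).mkQ.lTensor S z = 0) :
    z ∈ I.map (algebraMap R S) • (⊤ : Submodule S (S ⊗[R] M)) := by
  obtain ⟨w, rfl⟩ := (lTensor_exact S (LinearMap.exact_subtype_mkQ (I • (⊤ : Submodule R M)))
    (Submodule.mkQ_surjective _) z).mp hz
  clear hz
  induction w using TensorProduct.induction_on with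
  | zero => simp
  | add a b ha hb =>
    rw [map_add]
    exact Submodule.add_mem _ ha hb
  | tmul s v =>
    obtain ⟨v, hv⟩ := v
    simp only [LinearMap.lTensor_tmul, Submodule.subtype_apply]
    refine Submodule.smul_induction_on hv (fun r hr x _ => ?_) (fun x y hx hy => ?_)
    · rw [TensorProduct.tmul_smul, ← algebraMap_smul S r (s ⊗ₜ[R] x)]
      exact Submodule.smul_mem_smul (Ideal.mem_map_of_mem _ hr) trivial
    · rw [TensorProduct.tmul_add]
      exact Submodule.add_mem _ hx hy

variable {R : Type u} [CommRing R] [IsLocalRing R]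
  {S : Type u} [CommRing S] [IsLocalRing S] [Algebra R S]
  {M : Type v} [AddCommGroup M] [Module R M]

theorem isLocalHom_of_map_maximalIdeal_eq
    (hmax : (maximalIdeal R).map (algebraMap R S) = maximalIdeal S) :
    IsLocalHom (algebraMap R S) :=
  ((IsLocalRing.local_hom_TFAE (algebraMap R S)).out 0 2).mpr hmax.le

variable [Module.Flat R S]

/-- Flat base change multiplies length by ℓ(S/mS), which is 1. -/
theorem hilbertSamuelFunction_baseChange
    (hmax : (maximalIdeal R).map (algebraMap R S) = maximalIdeal S) (n : ℕ) :
    hilbertSamuelFunction S (S ⊗[R] M) n = hilbertSamuelFunction R M n := by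
  have := isLocalHom_of_map_maximalIdeal_eq hmax
  unfold hilbertSamuelFunction
  have h1 : Module.length S (S ⧸ (maximalIdeal R).map (algebraMap R S)) = 1 := by
    rw [hmax, Module.length_eq_one_iff, isSimpleModule_iff_isCoatom]
    exact (maximalIdeal.isMaximal S).out
  have h2 := (TensorProduct.tensorQuotMapSMulEquivTensorQuot M S (maximalIdeal R ^ n)).length_eq
  rw [IsLocalRing.length_baseChange, h1, mul_one, Ideal.map_pow, hmax] at h2
  rw [h2]

theorem HasWeaklyRegularSequence.baseChange
    (hmax : (maximalIdeal R).map (algebraMap R S) = maximalIdeal S) {d : ℕ}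
    (h : HasWeaklyRegularSequence R M d) :
    HasWeaklyRegularSequence S (S ⊗[R] M) d := by
  obtain ⟨rs, hl, hm, hr⟩ := h
  refine ⟨rs.map (algebraMap R S), by simpa using hl, ?_,
    hr.of_flat_of_isBaseChange (TensorProduct.isBaseChange R M S)⟩
  intro x hx
  obtain ⟨y, hy, rfl⟩ := List.mem_map.mp hx
  exact hmax ▸ Ideal.mem_map_of_mem _ (hm y hy)

/-- The regular sequence replaces a dimension formula for flat maps: each element lowers both
dimensions by one, and in dimension 0 a power of mS kills the module. -/
theorem supportDim_baseChange [IsNoetherianRing R] [IsNoetherianRing S] [Module.Finite R M]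
    (hmax : (maximalIdeal R).map (algebraMap R S) = maximalIdeal S) {d : ℕ}
    (h : HasWeaklyRegularSequence R M d) (hdim : Module.supportDim R M = d) :
    Module.supportDim S (S ⊗[R] M) = d := by
  have := isLocalHom_of_map_maximalIdeal_eq hmax
  have : Module.FaithfullyFlat R S := Module.FaithfullyFlat.of_flat_of_isLocalHom
  induction d generalizing M with
  | zero =>
    have := nontrivial_of_supportDim_eq_natCast hdim
    obtain ⟨c, hc⟩ := exists_maximalIdeal_pow_smul_eq_bot_of_supportDim_eq_zero hdim
    have hann : maximalIdeal S ^ c ≤ Module.annihilator S (S ⊗[R] M) := by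
      rw [← hmax, ← Ideal.map_pow, Ideal.map_le_iff_le_comap]
      intro r hr
      rw [Ideal.mem_comap, Module.mem_annihilator]
      intro z
      rw [algebraMap_smul]
      induction z using TensorProduct.induction_on with
      | zero => simp
      | add a b ha hb => rw [smul_add, ha, hb, add_zero]
      | tmul s v =>
        have : r • v = 0 := by
          rw [← Submodule.mem_bot R, ← hc]
          exact Submodule.smul_mem_smul hr trivial
        rw [← TensorProduct.tmul_smul, this, TensorProduct.tmul_zero]
    have hsub : Subsingleton (Module.support S (S ⊗[R] M)) := by
      have : ∀ q : Module.support S (S ⊗[R] M), q.1.asIdeal = maximalIdeal S := fun q => by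
        refine ((maximalIdeal.isMaximal S).eq_of_le q.1.2.ne_top ?_).symm
        have hq : q.1 ∈ PrimeSpectrum.zeroLocus (Module.annihilator S (S ⊗[R] M) : Set S) :=
          Module.support_eq_zeroLocus (R := S) (M := S ⊗[R] M) ▸ q.2
        exact q.1.2.le_of_pow_le (hann.trans hq)
      exact ⟨fun a b => Subtype.ext (PrimeSpectrum.ext ((this a).trans (this b).symm))⟩
    refine le_antisymm ?_ ?_
    · exact Order.krullDim_nonpos_of_subsingleton
    · have : Nonempty (Module.support S (S ⊗[R] M)) :=
        (Module.nonempty_support_iff.mpr inferInstance).to_subtype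
      exact Order.krullDim_nonneg
  | succ d ih =>
    have := nontrivial_of_supportDim_eq_natCast hdim
    obtain ⟨rs, hl, hm, hr⟩ := h
    match rs with
    | [] => simp at hl
    | x :: rs =>
      rw [RingTheory.Sequence.isWeaklyRegular_cons_iff] at hr
      have hx := hm x (by simp)
      have h1 := ih (M := QuotSMulTop x M)
        ⟨rs, by simpa using hl, fun y hy => hm y (by simp [hy]), hr.2⟩
        (supportDim_quotSMulTop_eq hx hr.1 hdim)
      have hx' : algebraMap R S x ∈ maximalIdeal S := hmax ▸ Ideal.mem_map_of_mem _ hx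
      have hreg : IsSMulRegular (S ⊗[R] M) (algebraMap R S x) :=
        hr.1.of_flat_of_isBaseChange (TensorProduct.isBaseChange R M S)
      rw [← Module.supportDim_quotSMulTop_succ_eq_supportDim hreg hx',
        Module.supportDim_eq_of_equiv (QuotSMulTop.algebraMapTensorEquivTensorQuotSMulTop x M S), h1]
      rfl

end BaseChange

/-! ### Descent to an arbitrary residue field. -/

section FiniteResidueField

universe u v w

variable {R : Type u} [CommRing R] [IsLocalRing R] {M : Type v} [AddCommGroup M] [Module R M]

theorem exists_tendsto_hilbertSamuelFunction' [IsNoetherianRing R] [Module.Finite R M] {d : ℕ}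
    (h : HasWeaklyRegularSequence R M d) (hdim : Module.supportDim R M = d) :
    ∃ e : ℝ, Tendsto (fun n : ℕ => (hilbertSamuelFunction R M n : ℝ) / (n : ℝ) ^ d) atTop
      (𝓝 e) := by
  obtain ⟨S, _, _, _, _, _, hmax, _⟩ := exists_flat_extension_infinite_residueField R
  have : Small.{max u v} S := small_max.{max u v} S
  simpa only [hilbertSamuelFunction_baseChange hmax] using
    exists_tendsto_hilbertSamuelFunction d (S ⊗[R] M) (h.baseChange hmax)
      (supportDim_baseChange hmax h hdim)

/-- The kernel condition is encoded by the maps `ψ` because identities between compositions survive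
tensoring with S. -/
theorem forall_eq_zero_of_sum_eq_zero' [IsNoetherianRing R] [Module.Finite R M]
    {ι : Type*} [Fintype ι] [DecidableEq ι] {d : ℕ}
    (hreg : HasWeaklyRegularSequence R M d) (hdim : Module.supportDim R M = d) {c : ℝ}
    (hc : Tendsto (fun n : ℕ => (hilbertSamuelFunction R M n : ℝ) / (n : ℝ) ^ d) atTop (𝓝 c))
    (hcle : (d.factorial : ℝ) * c ≤ hilbertSamuelFunction R M 1)
    {T : Type w} [AddCommGroup T] [Module R T] [Module.Finite R T] [Nontrivial T]
    (hT : HasWeaklyRegularSequence R T d) (φ : ι → M →ₗ[R] T)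
    (hsurj : ∀ t, ∃ m : ι → M, ∑ i, φ i (m i) = t)
    (ψ : ι → T →ₗ[R] (M ⧸ maximalIdeal R • (⊤ : Submodule R M)))
    (hψ : ∀ i j, ψ j ∘ₗ φ i = if i = j then (maximalIdeal R • (⊤ : Submodule R M)).mkQ else 0)
    (m : ι → M) (hm : ∑ i, φ i (m i) = 0) : m = 0 := by
  obtain ⟨S, _, _, _, _, _, hmax, _⟩ := exists_flat_extension_infinite_residueField R
  have : Small.{max u v} S := small_max.{max u v} S
  have : Small.{max u w} S := small_max.{max u w} S
  have := isLocalHom_of_map_maximalIdeal_eq hmax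
  have : Module.FaithfullyFlat R S := Module.FaithfullyFlat.of_flat_of_isLocalHom
  have key := forall_eq_zero_of_sum_eq_zero d (S ⊗[R] M) (hreg.baseChange hmax)
    (supportDim_baseChange hmax hreg hdim) c
    (by simpa only [hilbertSamuelFunction_baseChange hmax] using hc)
    (by simpa only [hilbertSamuelFunction_baseChange hmax] using hcle)
    (S ⊗[R] T) (hT.baseChange hmax) (fun i => (φ i).baseChange S)
    (fun t => by
      induction t using TensorProduct.induction_on with
      | zero => exact ⟨0, by simp⟩
      | add a b ha hb =>
        obtain ⟨x, rfl⟩ := ha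
        obtain ⟨y, rfl⟩ := hb
        exact ⟨x + y, by simp [Finset.sum_add_distrib]⟩
      | tmul s t =>
        obtain ⟨x, rfl⟩ := hsurj t
        exact ⟨fun i => s ⊗ₜ x i, by simp [TensorProduct.tmul_sum]⟩)
    (fun z hz j => by
      rw [← hmax]
      refine mem_map_smul_top_of_lTensor_mkQ_eq_zero _ _ ?_
      -- Applying S ⊗ ψ_j to the relation isolates the class of z_j in S ⊗ M/mM.
      have h1 := congrArg ((ψ j).lTensor S) hz
      rw [map_zero, map_sum] at h1
      rw [← h1, Finset.sum_eq_single j]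
      · change _ = (ψ j).lTensor S ((φ j).lTensor S (z j))
        rw [← LinearMap.comp_apply, ← LinearMap.lTensor_comp, hψ, if_pos rfl]
      · intro i _ hij
        change (ψ j).lTensor S ((φ i).lTensor S (z i)) = 0
        rw [← LinearMap.comp_apply, ← LinearMap.lTensor_comp, hψ, if_neg hij]
        simp
      · simp)
    (fun i => 1 ⊗ₜ m i) (by
      simp only [LinearMap.baseChange_tmul, ← TensorProduct.tmul_sum, hm, TensorProduct.tmul_zero])
  ext i
  exact (Module.FaithfullyFlat.one_tmul_eq_zero_iff R M (m i)).mp (congrFun key i)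

end FiniteResidueField

/-! ### Relations among minimal generators of N. -/

section Generators

universe u v w

variable {R : Type u} [CommRing R] [IsLocalRing R]

/-- Minimal generators of a module, with the dual basis modulo the maximal ideal. -/
theorem exists_minimal_generators (N : Type w) [AddCommGroup N] [Module R N] [Module.Finite R N] :
    ∃ (n : ℕ) (b : Fin n → N) (f : Fin n → N →ₗ[R] R ⧸ maximalIdeal R),
      Submodule.span R (Set.range b) = ⊤ ∧ ∀ i j, f j (b i) = if i = j then 1 else 0 := by
  let B := Module.finBasis (ResidueField R) (ResidueField R ⊗[R] N)
  have hs : Function.Surjective (TensorProduct.mk R (ResidueField R) N 1) := fun z => by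
    induction z using TensorProduct.induction_on with
    | zero => exact ⟨0, by simp⟩
    | add x y hx hy =>
      obtain ⟨x, rfl⟩ := hx
      obtain ⟨y, rfl⟩ := hy
      exact ⟨x + y, map_add _ _ _⟩
    | tmul a y =>
      obtain ⟨r, rfl⟩ := residue_surjective a
      refine ⟨r • y, ?_⟩
      rw [TensorProduct.mk_apply, TensorProduct.tmul_smul, TensorProduct.smul_tmul',
        Algebra.smul_def, mul_one]
      rfl
  choose b hb using fun i => hs (B i)
  refine ⟨_, b, fun j => ((B.coord j).restrictScalars R) ∘ₗ TensorProduct.mk R (ResidueField R) N 1,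
    span_eq_top_of_tmul_eq_basis b B hb, fun i j => ?_⟩
  change B.coord j (TensorProduct.mk R (ResidueField R) N 1 (b i)) = _
  rw [hb, Module.Basis.coord_apply, B.repr_self, Finsupp.single_apply]
  rfl

/-- For each v, the sum of the a_i v ⊗ b_i equals v ⊗ Σ a_i b_i = 0, so injectivity of M^n → M ⊗ N
gives a_i v = 0. The role of ψ_j is played by M ⊗ f_j, with values in M/mM. -/
theorem mem_annihilator_of_sum_smul_eq_zero [IsNoetherianRing R]
    {M : Type v} [AddCommGroup M] [Module R M] [Module.Finite R M]
    {N : Type w} [AddCommGroup N] [Module R N] [Module.Finite R N] [Nontrivial (M ⊗[R] N)]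
    {n d : ℕ} (b : Fin n → N) (f : Fin n → N →ₗ[R] R ⧸ maximalIdeal R)
    (hspan : Submodule.span R (Set.range b) = ⊤) (hf : ∀ i j, f j (b i) = if i = j then 1 else 0)
    (hreg : HasWeaklyRegularSequence R M d) (hdim : Module.supportDim R M = d) {c : ℝ}
    (hc : Tendsto (fun n : ℕ => (hilbertSamuelFunction R M n : ℝ) / (n : ℝ) ^ d) atTop (𝓝 c))
    (hcle : (d.factorial : ℝ) * c ≤ hilbertSamuelFunction R M 1)
    (hT : HasWeaklyRegularSequence R (M ⊗[R] N) d) (a : Fin n → R) (ha : ∑ i, a i • b i = 0)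
    (i : Fin n) : a i ∈ Module.annihilator R M := by
  rw [Module.mem_annihilator]
  intro v
  have key := forall_eq_zero_of_sum_eq_zero' hreg hdim hc hcle hT
    (fun i => (TensorProduct.mk R M N).flip (b i))
    (fun t => by
      induction t using TensorProduct.induction_on with
      | zero => exact ⟨0, by simp⟩
      | add x y hx hy =>
        obtain ⟨x, rfl⟩ := hx
        obtain ⟨y, rfl⟩ := hy
        exact ⟨x + y, by simp [Finset.sum_add_distrib]⟩
      | tmul m y =>
        have hy : y ∈ Submodule.span R (Set.range b) := hspan ▸ trivial
        obtain ⟨r, rfl⟩ := (Submodule.mem_span_range_iff_exists_fun R).mp hy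
        exact ⟨fun i => r i • m, by simp [TensorProduct.tmul_sum]⟩)
    (fun j => (TensorProduct.tensorQuotEquivQuotSMul M (maximalIdeal R)).toLinearMap ∘ₗ
      (f j).lTensor M)
    (fun i j => by
      ext m
      simp only [LinearMap.comp_apply, LinearMap.flip_apply, TensorProduct.mk_apply,
        LinearMap.lTensor_tmul, hf, LinearEquiv.coe_coe]
      split_ifs with h
      · have := TensorProduct.tensorQuotEquivQuotSMul_tmul_mk (maximalIdeal R) m 1
        rw [map_one, one_smul] at this
        exact this
      · simp)
    (fun i => a i • v)
    (by
      simp only [LinearMap.flip_apply, TensorProduct.mk_apply, TensorProduct.smul_tmul]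
      rw [← TensorProduct.tmul_sum, ha, TensorProduct.tmul_zero])
  exact congrFun key i

theorem nontrivial_tensorProduct {M : Type v} [AddCommGroup M] [Module R M] [Module.Finite R M]
    [Nontrivial M] {N : Type w} [AddCommGroup N] [Module R N] [Module.Finite R N] [Nontrivial N] :
    Nontrivial (M ⊗[R] N) := by
  obtain ⟨n, b, f, hspan, hf⟩ := exists_minimal_generators (R := R) N
  have hM : Nontrivial (M ⧸ maximalIdeal R • (⊤ : Submodule R M)) :=
    Submodule.Quotient.nontrivial_iff.mpr
      (Submodule.top_ne_ideal_smul_of_le_jacobson_annihilator (maximalIdeal_le_jacobson _)).symm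
  have hn : 0 < n := by
    rcases Nat.eq_zero_or_pos n with rfl | h
    · simp only [Set.range_eq_empty, Submodule.span_empty] at hspan
      exact absurd hspan bot_ne_top
    · exact h
  have hsurj : Function.Surjective ((TensorProduct.tensorQuotEquivQuotSMul M
      (maximalIdeal R)).toLinearMap ∘ₗ (f ⟨0, hn⟩).lTensor M) := fun y => by
    obtain ⟨m, rfl⟩ := Submodule.mkQ_surjective _ y
    refine ⟨m ⊗ₜ b ⟨0, hn⟩, ?_⟩
    rw [LinearMap.comp_apply, LinearMap.lTensor_tmul, hf, if_pos rfl]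
    have := TensorProduct.tensorQuotEquivQuotSMul_tmul_mk (maximalIdeal R) m 1
    rw [map_one, one_smul] at this
    exact this
  exact hsurj.nontrivial

end Generators

/-! ### Modules with rank. -/

section Rank

universe u v w

variable {R : Type u} [CommRing R]

theorem supportDim_tensorProduct_le {M : Type v} [AddCommGroup M] [Module R M] [Module.Finite R M]
    {N : Type w} [AddCommGroup N] [Module R N] [Module.Finite R N] :
    Module.supportDim R (M ⊗[R] N) ≤ Module.supportDim R M := by
  rw [Module.supportDim_eq_ringKrullDim_quotient_annihilator,
    Module.supportDim_eq_ringKrullDim_quotient_annihilator]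
  have hle : Module.annihilator R M ≤ Module.annihilator R (M ⊗[R] N) := fun r hr => by
    rw [Module.mem_annihilator] at hr ⊢
    intro z
    induction z using TensorProduct.induction_on with
    | zero => simp
    | add x y hx hy => rw [smul_add, hx, hy, add_zero]
    | tmul m y => rw [TensorProduct.smul_tmul', hr, TensorProduct.zero_tmul]
  exact ringKrullDim_le_of_surjective _ (Ideal.Quotient.factor_surjective hle)

/-- If `dim M = dim R` is finite, then the annihilator of `M` is contained in an associated prime
of `R`. -/
theorem exists_mem_associatedPrimes_annihilator_le [IsNoetherianRing R] {M : Type v}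
    [AddCommGroup M] [Module R M] [Module.Finite R M] {d : ℕ} (hdim : Module.supportDim R M = d)
    (hR : ringKrullDim R = d) :
    ∃ p ∈ associatedPrimes R R, Module.annihilator R M ≤ p := by
  by_contra! h
  have hmin : ∀ p ∈ minimalPrimes R, ¬ Module.annihilator R M ≤ p := fun p hp => by
    refine h p (Module.associatedPrimes.minimalPrimes_annihilator_subset_associatedPrimes R R ?_)
    rwa [Module.annihilator_eq_bot.mpr inferInstance]
  have : Nonempty (Module.support R M) := by
    have := nontrivial_of_supportDim_eq_natCast hdim
    exact (Module.nonempty_support_iff.mpr inferInstance).to_subtype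
  obtain ⟨l, hl⟩ := Order.le_krullDim_iff.mp (hdim.ge : (d : WithBot ℕ∞) ≤ Order.krullDim _)
  have hhead : Module.annihilator R M ≤ l.head.1.asIdeal := by
    have : l.head.1 ∈ PrimeSpectrum.zeroLocus (Module.annihilator R M : Set R) :=
      Module.support_eq_zeroLocus (R := R) (M := M) ▸ l.head.2
    exact this
  -- A chain of length d in Supp M not starting at a minimal prime of R could be prolonged
  -- downwards, against dim R = d.
  obtain ⟨q, hq, hql⟩ := Ideal.exists_minimalPrimes_le (bot_le : (⊥ : Ideal R) ≤ l.head.1.asIdeal)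
  have hne : q ≠ l.head.1.asIdeal := fun h' => hmin q hq (h' ▸ hhead)
  let q' : PrimeSpectrum R := ⟨q, hq.1.1⟩
  let l' : LTSeries (PrimeSpectrum R) := l.map Subtype.val (fun _ _ h => h)
  have hlt : q' < l'.head := by
    change q' < l.head.1
    exact lt_of_le_of_ne hql fun h' => hne (congrArg PrimeSpectrum.asIdeal h')
  have := Order.LTSeries.length_le_krullDim (RelSeries.cons l' q' hlt)
  rw [RelSeries.cons_length] at this
  change _ ≤ ringKrullDim R at this
  rw [hR] at this
  have h2 : l'.length = d := hl
  rw [h2] at this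
  have : d + 1 ≤ d := by exact_mod_cast this
  omega

/-- A surjection of free modules of finite rank over a local ring is bijective if its kernel
lies in the maximal ideal times the source. -/
theorem bijective_of_ker_le_maximalIdeal_smul {A : Type*} [CommRing A] [IsLocalRing A] {F G : Type*}
    [AddCommGroup F] [Module A F] [Module.Finite A F] [AddCommGroup G] [Module A G]
    [Module.Free A G] (g : F →ₗ[A] G) (hg : Function.Surjective g)
    (hker : LinearMap.ker g ≤ maximalIdeal A • (⊤ : Submodule A F)) : Function.Bijective g := by
  obtain ⟨s, hs⟩ := Module.projective_lifting_property g LinearMap.id hg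
  have hgs : ∀ y, g (s y) = y := fun y => LinearMap.congr_fun hs y
  -- By Nakayama: v - s(g v) lies in the kernel, so s(G) + mF = F.
  have hrange : LinearMap.range s = ⊤ := by
    have h1 : (⊤ : Submodule A F) ≤ LinearMap.range s ⊔ maximalIdeal A • (⊤ : Submodule A F) := by
      intro v _
      rw [← add_sub_cancel (s (g v)) v]
      refine Submodule.add_mem_sup ⟨_, rfl⟩ (hker ?_)
      rw [LinearMap.mem_ker, map_sub, hgs, sub_self]
    exact top_le_iff.mp (Submodule.le_of_le_smul_of_le_jacobson_bot Module.Finite.fg_top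
      (maximalIdeal_le_jacobson _) h1)
  refine ⟨fun x y hxy => ?_, hg⟩
  obtain ⟨x, rfl⟩ := LinearMap.range_eq_top.mp hrange x
  obtain ⟨y, rfl⟩ := LinearMap.range_eq_top.mp hrange y
  rw [hgs, hgs] at hxy
  rw [hxy]

/-- The annihilator of a nonzero a lies in some associated prime p, and a survives in R_p. -/
theorem eq_zero_of_forall_associatedPrimes [IsNoetherianRing R] (a : R)
    (h : ∀ (p : Ideal R) [p.IsPrime], p ∈ associatedPrimes R R →
      algebraMap R (Localization.AtPrime p) a = 0) : a = 0 := by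
  by_contra ha
  obtain ⟨p, hp, hle⟩ := exists_le_isAssociatedPrime_of_isNoetherianRing R a ha
  have := hp.isPrime
  obtain ⟨s, hs⟩ := (IsLocalization.map_eq_zero_iff p.primeCompl (Localization.AtPrime p) a).mp
    (h p hp)
  refine s.2 (hle ?_)
  simpa [Submodule.mem_colon_singleton] using hs

/-- If `N` has rank, generators of `N` all of whose relations have coefficients in an ideal
contained in some associated prime of `R` satisfy no nontrivial relation. -/
theorem HasModuleRank.eq_zero_of_sum_smul_eq_zero [IsNoetherianRing R] {N : Type w}
    [AddCommGroup N] [Module R N] (hN : HasModuleRank R N) {n : ℕ} (b : Fin n → N)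
    (hspan : Submodule.span R (Set.range b) = ⊤) (I : Ideal R)
    (hI : ∃ p ∈ associatedPrimes R R, I ≤ p)
    (hrel : ∀ a : Fin n → R, ∑ i, a i • b i = 0 → ∀ i, a i ∈ I)
    (a : Fin n → R) (ha : ∑ i, a i • b i = 0) : a = 0 := by
  obtain ⟨r, hr⟩ := hN
  let g : ∀ (p : Ideal R) [p.IsPrime], (Fin n → Localization.AtPrime p) →ₗ[Localization.AtPrime p]
    LocalizedModule p.primeCompl N := fun p _ =>
      Fintype.linearCombination (Localization.AtPrime p)
        (fun i => LocalizedModule.mkLinearMap p.primeCompl N (b i))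
  have hg : ∀ (p : Ideal R) [p.IsPrime], Function.Surjective (g p) := fun p _ => by
    rw [← LinearMap.range_eq_top, Fintype.range_linearCombination, Set.range_comp']
    exact span_eq_top_of_isLocalizedModule (Localization.AtPrime p) p.primeCompl
      (LocalizedModule.mkLinearMap p.primeCompl N) hspan
  obtain ⟨p, hp, hIp⟩ := hI
  -- Clearing denominators turns a relation over R_p into one over R, whose coefficients lie in I ≤
  -- p. So R_p^n → N_p ≅ R_p^r has kernel inside pR_p^n and is bijective.
  have hnr : n = r := by
    have := hp.isPrime
    obtain ⟨e⟩ := hr p hp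
    have hbij := bijective_of_ker_le_maximalIdeal_smul (e.toLinearMap ∘ₗ g p)
      (e.surjective.comp (hg p)) (by
        intro x hx
        have hx' : g p x = 0 := by simpa using hx
        obtain ⟨s, hs⟩ := IsLocalization.exist_integer_multiples_of_finite p.primeCompl x
        choose y hy using hs
        have h1 : g p (fun i => algebraMap R (Localization.AtPrime p) (y i)) = 0 := by
          have : (fun i => algebraMap R (Localization.AtPrime p) (y i)) =
              algebraMap R (Localization.AtPrime p) s • x := funext fun i => by
            rw [hy, Pi.smul_apply, algebraMap_smul]
          rw [this, map_smul, hx', smul_zero]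
        have h2 : LocalizedModule.mkLinearMap p.primeCompl N (∑ i, y i • b i) = 0 := by
          rw [← h1]
          simp [g, Fintype.linearCombination_apply]
        obtain ⟨t, ht⟩ := (IsLocalizedModule.eq_zero_iff p.primeCompl
          (LocalizedModule.mkLinearMap p.primeCompl N)).mp h2
        have h3 : ∀ i, y i ∈ p := fun i => by
          have h4 := hIp (hrel (fun i => (t : R) * y i) (by
            simp only [mul_smul, ← Finset.smul_sum]
            exact ht) i)
          exact (‹p.IsPrime›.mem_or_mem h4).resolve_left t.2
        have h5 : ∀ i, x i ∈ maximalIdeal (Localization.AtPrime p) := fun i => by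
          have h6 : algebraMap R (Localization.AtPrime p) s * x i ∈
              maximalIdeal (Localization.AtPrime p) := by
            rw [← Algebra.smul_def, ← hy,
              IsLocalization.AtPrime.to_map_mem_maximal_iff (Localization.AtPrime p) p]
            exact h3 i
          exact (Ideal.unit_mul_mem_iff_mem _ (IsLocalization.map_units _ s)).mp h6
        rw [pi_eq_sum_univ' x]
        exact Submodule.sum_mem _ fun i _ => Submodule.smul_mem_smul (h5 i) trivial)
    have e' := LinearEquiv.ofBijective _ hbij
    simpa using e'.finrank_eq
  subst hnr
  ext i
  refine eq_zero_of_forall_associatedPrimes (a i) fun q _ hq => ?_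
  obtain ⟨e⟩ := hr q hq
  -- With n = r this is a surjective endomorphism of a finite module.
  have hinj : Function.Injective (e.toLinearMap ∘ₗ g q) :=
    OrzechProperty.injective_of_surjective_endomorphism _ (e.surjective.comp (hg q))
  have h0 : g q (fun i => algebraMap R (Localization.AtPrime q) (a i)) = 0 := by
    simp only [g, Fintype.linearCombination_apply, algebraMap_smul, ← map_smul, ← map_sum, ha,
      map_zero]
  have h1 : (fun i => algebraMap R (Localization.AtPrime q) (a i)) = 0 :=
    hinj (by simp [h0])
  exact congrFun h1 i

end Rank

theorem mainTheorem3 {R : Type*} [CommRing R] [IsNoetherianRing R] [IsLocalRing R]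
    {M : Type*} [AddCommGroup M] [Module R M] [Module.Finite R M] [Nontrivial M]
    {N : Type*} [AddCommGroup N] [Module R N] [Module.Finite R N] [Nontrivial N]
    (hMN : FaithfulSMul R M ∨ HasModuleRank R N)
    (hM : IsUlrichModule R M)
    (hT : IsMaximalCohenMacaulayModule R (M ⊗[R] N)) :
    Module.Free R N := by
  have hnt : Nontrivial (M ⊗[R] N) := nontrivial_tensorProduct
  have hTdim := hT.2.resolve_left (not_subsingleton _)
  have hTdepth := hT.1.resolve_left (not_subsingleton _)
  have hMdepth := hM.isCohenMacaulay.resolve_left (not_subsingleton _)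
  -- dim R = dim (M ⊗ N) ≤ dim M ≤ dim R, so M is itself maximal Cohen–Macaulay.
  have hMdim : Module.supportDim R M = ringKrullDim R :=
    le_antisymm (Module.supportDim_le_ringKrullDim R M) (hTdim ▸ supportDim_tensorProduct_le)
  obtain ⟨d, hd⟩ : ∃ d : ℕ, moduleDepth R M = d := by
    refine ⟨(moduleDepth R M).toNat, (ENat.natCast_toNat fun h => ?_).symm⟩
    have h1 : ringKrullDim R < ⊤ := ringKrullDim_lt_top
    rw [← hMdim, ← hMdepth, h] at h1
    exact lt_irrefl _ h1
  rw [hd] at hMdepth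
  have hR : ringKrullDim R = d := by rw [← hMdim, ← hMdepth]; rfl
  have hMdim' : Module.supportDim R M = d := hMdim.trans hR
  have hTd : moduleDepth R (M ⊗[R] N) = d := by
    rw [hTdim, hR] at hTdepth
    exact WithBot.coe_injective hTdepth
  have hreg := HasWeaklyRegularSequence.of_moduleDepth_eq hd
  obtain ⟨c, hc⟩ := exists_tendsto_hilbertSamuelFunction' hreg hMdim'
  have hdn : moduleDimNat R M = d := by
    unfold moduleDimNat
    rw [hMdim']
    rfl
  have hcle : (d.factorial : ℝ) * c ≤ hilbertSamuelFunction R M 1 := by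
    have h1 := hM.multiplicity_le
    unfold hilbertSamuelMultiplicity at h1
    rw [hdn, one_mul] at h1
    have h2 := hc.limUnder_eq
    unfold hilbertSamuelFunction at h2 ⊢
    rw [h2] at h1
    rwa [pow_one]
  obtain ⟨n, b, f, hspan, hf⟩ := exists_minimal_generators (R := R) N
  have hrel : ∀ a : Fin n → R, ∑ i, a i • b i = 0 → ∀ i, a i ∈ Module.annihilator R M :=
    fun a ha i => mem_annihilator_of_sum_smul_eq_zero b f hspan hf hreg hMdim' hc hcle
      (HasWeaklyRegularSequence.of_moduleDepth_eq hTd) a ha i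
  have hind : LinearIndependent R b := by
    rw [Fintype.linearIndependent_iff]
    intro a ha i
    rcases hMN with h | h
    · have := hrel a ha i
      rwa [Module.annihilator_eq_bot.mpr h, Ideal.mem_bot] at this
    · exact congrFun (h.eq_zero_of_sum_smul_eq_zero b hspan (Module.annihilator R M)
        (exists_mem_associatedPrimes_annihilator_le hMdim' hR) hrel a ha) i
  exact Module.Free.of_basis (Module.Basis.mk hind hspan.ge)
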